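/- For a topological space $Y$ let $S_n(Y)$ be the set of singular $n$-simplices $\Delta_n\to Y$ with the compact-open topology, and let $C^n(Y)$ be the space of real singular $n$-cochains, i.e. of real functions on $S_n(Y)$, with the norm $\|\varphi\|=\sup_{s\in S_n(Y)}|\varphi(s)|\in[0,\infty]$. Let $C_c^*(Y)$, $C_b^*(Y)$ and $C_{b,c}^*(Y)=C_c^*(Y)\cap C_b^*(Y)$ be the subcomplexes of cochains that are continuous on $S_*(Y)$, bounded, and both. Let $H^*(Y),H_c^*(Y),H_b^*(Y),H_{b,c}^*(Y)$ be the cohomologies of $C^*(Y),C_c^*(Y),C_b^*(Y),C_{b,c}^*(Y)$, each with the seminorm (with values in $[0,\infty]$) of a class given by the infimum of the norms of the cocycles representing it. Let $i^*\colon H_c^*(Y)\to H^*(Y)$ and $i_b^*\colon H_{b,c}^*(Y)\to H_b^*(Y)$ be induced by the inclusions. **Theorem.** Let $X$ be a path connected, paracompact Hausdorff space with contractible universal covering $p\colon\widetilde X\to X$, and let $\Gamma$ be the group of covering automorphisms of $p$. Then for every $n\ge 0$ the maps $i^n\colon H_c^n(X)\to H^n(X)$ and $i_b^n\colon H_{b,c}^n(X)\to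 H_b^n(X)$ are linear isomorphisms which preserve the seminorms. Moreover, there exists a generalized Bruhat function, that is, a continuous function $h\colon\widetilde X\to[0,1]$ such that every $x\in\widetilde X$ has a neighbourhood $W$ for which $\{g\in\Gamma : g(W)\cap\operatorname{supp}h\ne\emptyset\}$ is finite, and such that $\sum_{g\in\Gamma}h(gx)=1$ for every $x\in\widetilde X$; there exist $x_0\in\widetilde X$ and a homotopy $H\colon\widetilde X\times[0,1]\to\widetilde X$ with $H(x,0)=x$ and $H(x,1)=x_0$ for all $x$; and every singular simplex of $X$ lifts to $\widetilde X$. For any such $h$, $x_0$ and $H$, the inverses of $i^n$ and $i_b^n$ are given as follows. For $s\in S_n(\widetilde X)$ let $T_n(s)\in S_{n+1}(\widetilde X)$ be the cone $$T_n(s)\big(te_0+(1-t)q\big)=H(s(r(q)),t),$$ where $q$ lies in the face of $\Delta_{n+1}$ opposite to the vertex $e_0$ and $r$ identifies this face with $\Delta_n$, preserving the order of the vertices. Define simplices $\bar s(g_0,\dots,g_n)\in S_n(\widetilde X)$, for $(g_0,\dots,g_n)\in\Gamma^{n+1}$, by $\bar s(g_0)=g_0(x_0)$ and $$\bar s(g_0,\dots,g_{n+1})=g_0\cdot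 T_n\big(g_0^{-1}\cdot\bar s(g_1,\dots,g_{n+1})\big),$$ and for $\widetilde\varphi\in C^n(\widetilde X)$ and $\widetilde s\in S_n(\widetilde X)$ put $$\widetilde\theta^n(\widetilde\varphi)(\widetilde s)=\sum_{(g_0,\dots,g_n)\in\Gamma^{n+1}}h(g_0^{-1}\widetilde s(e_0))\cdots h(g_n^{-1}\widetilde s(e_n))\,\widetilde\varphi(\bar s(g_0,\dots,g_n)),$$ a sum in which only finitely many of the products of values of $h$ are nonzero. Then for every cocycle $\varphi\in C^n(X)$ (respectively $\varphi\in C_b^n(X)$) the class $(i^n)^{-1}[\varphi]$ (respectively $(i_b^n)^{-1}[\varphi]$) is represented by the cocycle in $C_c^n(X)$ (respectively $C_{b,c}^n(X)$) which maps every $s\in S_n(X)$ to $\widetilde\theta^n(p^*\varphi)(\widetilde s)$, where $\widetilde s$ is any lift of $s$ to $\widetilde X$. -/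

import Mathlib

open scoped ENNReal Topology

noncomputable section

namespace ContCohomology

/-! ### Singular simplices and singular cochains -/

/-- The set `S_n(X)` of singular `n`-simplices. As a space of continuous maps it carries Mathlib's
topology on `C(_, _)`, which is the compact-open topology. -/
abbrev Simp (n : ℕ) (X : Type*) [TopologicalSpace X] : Type _ :=
  C(stdSimplex ℝ (Fin (n + 1)), X)

/-- The affine inclusion of the standard `n`-simplex as the face opposite to the `i`-th vertex of
the standard `(n+1)`-simplex. -/
def faceIncl (n : ℕ) (i : Fin (n + 2)) :
    C(stdSimplex ℝ (Fin (n + 1)), stdSimplex ℝ (Fin (n + 2))) :=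
  ⟨stdSimplex.map i.succAbove, stdSimplex.continuous_map _⟩

/-- Real singular `n`-cochains. A linear functional on the real vector space with basis `S_n(X)`
is the same as a real function on `S_n(X)`. -/
abbrev Cochain (n : ℕ) (X : Type*) [TopologicalSpace X] : Type _ := Simp n X → ℝ

variable {X : Type*} [TopologicalSpace X]

/-- The usual singular coboundary. -/
def coboundary (n : ℕ) : Cochain n X →ₗ[ℝ] Cochain (n + 1) X where
  toFun φ s := ∑ i : Fin (n + 2), (-1 : ℝ) ^ (i : ℕ) * φ (s.comp (faceIncl n i))
  map_add' φ ψ := by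
    funext s
    simp [mul_add, Finset.sum_add_distrib]
  map_smul' c φ := by
    funext s
    simp only [Pi.smul_apply, smul_eq_mul, RingHom.id_apply, Finset.mul_sum]
    exact Finset.sum_congr rfl fun i _ => by ring

/-- The sup norm of a cochain, with values in `[0, ∞]`. -/
def supNorm {n : ℕ} (φ : Cochain n X) : ℝ≥0∞ := ⨆ s : Simp n X, ‖φ s‖ₑ

/-! ### Subcomplexes of the singular cochain complex, cohomology, seminorms -/

/-- A subcomplex of the complex of real singular cochains of `X`. -/
structure Subcomplex (X : Type*) [TopologicalSpace X] where
  carrier : ∀ n, Submodule ℝ (Cochain n X)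
  coboundary_mem : ∀ n, ∀ φ ∈ carrier n, coboundary n φ ∈ carrier (n + 1)

/-- `C^*(X)`: all singular cochains. -/
def allCochains (X : Type*) [TopologicalSpace X] : Subcomplex X where
  carrier _ := ⊤
  coboundary_mem _ _ _ := trivial

/-- `C_c^*(X)`: the cochains whose restriction to singular simplices is continuous. -/
def contCochains (X : Type*) [TopologicalSpace X] : Subcomplex X where
  carrier n :=
    { carrier := {φ | Continuous φ}
      add_mem' := fun ha hb => Continuous.add ha hb
      zero_mem' := continuous_const
      smul_mem' := fun c _ ha => Continuous.const_smul ha c }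
  coboundary_mem n φ hφ := by
    have hφ' : Continuous φ := hφ
    change Continuous fun s : Simp (n + 1) X =>
      ∑ i : Fin (n + 2), (-1 : ℝ) ^ (i : ℕ) * φ (s.comp (faceIncl n i))
    refine continuous_finsetSum _ fun i _ => continuous_const.mul (hφ'.comp ?_)
    exact ContinuousMap.continuous_precomp (faceIncl n i)

/-- `C_b^*(X)`: the cochains of finite sup norm. -/
def bddCochains (X : Type*) [TopologicalSpace X] : Subcomplex X where
  carrier n :=
    { carrier := {φ | supNorm φ < ⊤}
      add_mem' := by
        intro a b ha hb
        refine lt_of_le_of_lt (iSup_le fun s => ?_) (ENNReal.add_lt_top.2 ⟨ha, hb⟩)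
        exact (enorm_add_le _ _).trans (add_le_add (le_iSup (fun s => ‖a s‖ₑ) s)
          (le_iSup (fun s => ‖b s‖ₑ) s))
      zero_mem' := by simp [supNorm]
      smul_mem' := by
        intro c a ha
        refine lt_of_le_of_lt (iSup_le fun s => ?_)
          (ENNReal.mul_lt_top (enorm_lt_top (x := c)) ha)
        rw [Pi.smul_apply, enorm_smul]
        gcongr
        exact le_iSup (fun s => ‖a s‖ₑ) s }
  coboundary_mem n φ hφ := by
    have hφ' : supNorm φ < ⊤ := hφ
    change supNorm (coboundary n φ) < ⊤
    refine lt_of_le_of_lt (b := ∑ _i : Fin (n + 2), supNorm φ) (iSup_le fun s => ?_)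
      (ENNReal.sum_lt_top.2 fun _ _ => hφ')
    refine (enorm_sum_le _ _).trans (Finset.sum_le_sum fun i _ => ?_)
    rw [enorm_mul, enorm_pow, enorm_neg, enorm_one, one_pow, one_mul]
    exact le_iSup (fun s => ‖φ s‖ₑ) _

/-- `C_{b,c}^*(X)`: the cochains that are both bounded and continuous. -/
def bddContCochains (X : Type*) [TopologicalSpace X] : Subcomplex X where
  carrier n := (contCochains X).carrier n ⊓ (bddCochains X).carrier n
  coboundary_mem n φ hφ :=
    ⟨(contCochains X).coboundary_mem n φ hφ.1, (bddCochains X).coboundary_mem n φ hφ.2⟩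

/-- The cocycles `Z^n(K)` of a subcomplex. -/
def cocycles (K : Subcomplex X) (n : ℕ) : Submodule ℝ (Cochain n X) :=
  K.carrier n ⊓ LinearMap.ker (coboundary n)

/-- The coboundaries `B^n(K)` of a subcomplex: differentials of cochains of `K`. -/
def coboundaries (K : Subcomplex X) : ∀ n : ℕ, Submodule ℝ (Cochain n X)
  | 0 => ⊥
  | n + 1 => (K.carrier n).map (coboundary n)

/-- The cohomology `H^n(K) = Z^n(K) / B^n(K)`. -/
abbrev Cohomology (K : Subcomplex X) (n : ℕ) : Type _ :=
  cocycles K n ⧸ (coboundaries K n).comap (cocycles K n).subtype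

/-- The cohomology class of a cocycle. -/
def cls (K : Subcomplex X) (n : ℕ) : cocycles K n →ₗ[ℝ] Cohomology K n :=
  Submodule.mkQ _

/-- The seminorm (with values in `[0, ∞]`) induced by the sup norm on cohomology. -/
def seminorm {K : Subcomplex X} {n : ℕ} (c : Cohomology K n) : ℝ≥0∞ :=
  ⨅ (ψ : cocycles K n) (_ : cls K n ψ = c), supNorm (ψ : Cochain n X)

/-- The map in cohomology induced by an inclusion `K ⊆ L` of subcomplexes. -/
def inducedMap {K L : Subcomplex X} (h : ∀ n, K.carrier n ≤ L.carrier n) (n : ℕ) :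
    Cohomology K n →ₗ[ℝ] Cohomology L n :=
  Submodule.mapQ _ _ (Submodule.inclusion (inf_le_inf_right _ (h n))) (by
    rintro ⟨φ, hφ⟩ hb
    cases n with
    | zero => exact hb
    | succ n => exact Submodule.map_mono (h n) hb)

/-- `i^n : H_c^n(X) → H^n(X)`. -/
def iMap (X : Type*) [TopologicalSpace X] (n : ℕ) :
    Cohomology (contCochains X) n →ₗ[ℝ] Cohomology (allCochains X) n :=
  inducedMap (fun _ => le_top) n

/-- `i_b^n : H_{b,c}^n(X) → H_b^n(X)`. -/
def ibMap (X : Type*) [TopologicalSpace X] (n : ℕ) :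
    Cohomology (bddContCochains X) n →ₗ[ℝ] Cohomology (bddCochains X) n :=
  inducedMap (fun _ => inf_le_right) n

/-! ### Covering automorphisms and generalized Bruhat functions -/

variable {E : Type*} [TopologicalSpace E]

/-- The group `Γ` of covering automorphisms of `p : E → X`. -/
def Deck (p : E → X) : Subgroup (E ≃ₜ E) where
  carrier := {g | ∀ x, p (g x) = p x}
  mul_mem' := fun {a b} ha hb x => (ha (b x)).trans (hb x)
  one_mem' := fun _ => rfl
  inv_mem' := fun {a} ha x => by
    rw [← ha (a⁻¹ x)]
    exact congrArg p (a.apply_symm_apply x)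

/-- Generalized Bruhat functions for the covering `p : E → X`. In the last condition the sum has
only finitely many nonzero terms, by the preceding condition. -/
structure IsBruhat (p : E → X) (h : E → ℝ) : Prop where
  continuous : Continuous h
  mem_Icc : ∀ x, h x ∈ Set.Icc (0 : ℝ) 1
  locally_finite : ∀ x, ∃ W ∈ 𝓝 x, {g : Deck p | ((g.1 '' W) ∩ tsupport h).Nonempty}.Finite
  sum_eq_one : ∀ x, ∑ᶠ g : Deck p, h (g.1 x) = 1

/-! ### Cones and the simplices spanned by the orbit of a point -/

/-- The point `(t₁, …, t_{n+1}) / (1 - t₀)` of the standard `n`-simplex: the (reindexed) projection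
from the `0`-th vertex to the opposite face of a point `t` other than that vertex. -/
def proj0 {n : ℕ} (t : stdSimplex ℝ (Fin (n + 2))) (ht : t 0 ≠ 1) :
    stdSimplex ℝ (Fin (n + 1)) :=
  ⟨fun i => t i.succ / (1 - t 0), by
    have h1 : 0 < 1 - t 0 := sub_pos.2 (lt_of_le_of_ne (stdSimplex.le_one t 0) ht)
    refine ⟨fun i => div_nonneg (stdSimplex.zero_le t _) h1.le, ?_⟩
    have hs := stdSimplex.sum_eq_one t
    rw [Fin.sum_univ_succ] at hs
    rw [← Finset.sum_div, div_eq_one_iff_eq h1.ne']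
    linarith⟩

open Classical in
/-- The map underlying the cone over `s`: it sends `t e₀ + (1 - t) q`, with `q` on the face
opposite to `e₀`, to `H(s(q), t)`; in particular it sends `e₀` to `x₀`. -/
def coneFun {x₀ : E} (H : (ContinuousMap.id E).Homotopy (ContinuousMap.const E x₀)) {n : ℕ}
    (s : Simp n E) (t : stdSimplex ℝ (Fin (n + 2))) : E :=
  if ht : t 0 = 1 then x₀
  else H (⟨t 0, stdSimplex.zero_le t 0, stdSimplex.le_one t 0⟩, s (proj0 t ht))

lemma continuous_coneFun {x₀ : E}
    (H : (ContinuousMap.id E).Homotopy (ContinuousMap.const E x₀)) {n : ℕ}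
    (s : Simp n E) : Continuous (coneFun H s) := by
  classical
  have hc : ∀ i : Fin (n + 2), Continuous fun t : stdSimplex ℝ (Fin (n + 2)) => t i := fun i =>
    (continuous_apply i).comp continuous_subtype_val
  rw [continuous_iff_continuousAt]
  intro t
  by_cases ht : t 0 = 1
  · have hx : coneFun H s t = x₀ := dif_pos ht
    rw [ContinuousAt, hx, tendsto_nhds]
    intro U hU hxU
    have hK : IsCompact (Set.range s) := isCompact_range s.continuous
    obtain ⟨u, v, hu, -, hsu, hv, huv⟩ := generalized_tube_lemma
      (isCompact_singleton (x := (1 : unitInterval))) hK (hU.preimage H.continuous) (by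
        rintro ⟨a, b⟩ ⟨ha, -⟩
        obtain rfl : a = 1 := ha
        have hab : H (1, b) = x₀ := by simp
        simpa [hab] using hxU)
    have hcu : Continuous fun t : stdSimplex ℝ (Fin (n + 2)) =>
        (⟨t 0, stdSimplex.zero_le t 0, stdSimplex.le_one t 0⟩ : unitInterval) :=
      (hc 0).subtype_mk _
    have h1 : (⟨t 0, stdSimplex.zero_le t 0, stdSimplex.le_one t 0⟩ : unitInterval) ∈ u := by
      have : (⟨t 0, stdSimplex.zero_le t 0, stdSimplex.le_one t 0⟩ : unitInterval) = 1 :=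
        Subtype.ext ht
      rw [this]
      exact hsu rfl
    filter_upwards [hcu.continuousAt.preimage_mem_nhds (hu.mem_nhds h1)] with t' ht'
    change coneFun H s t' ∈ U
    by_cases h2 : t' 0 = 1
    · rw [coneFun, dif_pos h2]
      exact hxU
    · rw [coneFun, dif_neg h2]
      exact huv (Set.mk_mem_prod ht' (hv (Set.mem_range_self _)))
  · have ho : IsOpen {t : stdSimplex ℝ (Fin (n + 2)) | t 0 ≠ 1} :=
      isOpen_ne.preimage (hc 0)
    refine ContinuousOn.continuousAt ?_ (ho.mem_nhds ht)
    rw [continuousOn_iff_continuous_domRestrict]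
    have he : Set.domRestrict {t : stdSimplex ℝ (Fin (n + 2)) | t 0 ≠ 1} (coneFun H s) = fun t =>
        H (⟨t.1 0, stdSimplex.zero_le t.1 0, stdSimplex.le_one t.1 0⟩, s (proj0 t.1 t.2)) := by
      funext t
      exact dif_neg t.2
    rw [he]
    refine H.continuous.comp (Continuous.prodMk
      (((hc 0).comp continuous_subtype_val).subtype_mk _) (s.continuous.comp ?_))
    refine Continuous.subtype_mk (continuous_pi fun i => ?_) _
    exact ((hc i.succ).comp continuous_subtype_val).div
      (continuous_const.sub ((hc 0).comp continuous_subtype_val))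
      fun t => sub_ne_zero.2 (Ne.symm t.2)

/-- The cone `T_n(s)` over a singular simplex `s`, with vertex `x₀`, built from a homotopy `H`
between the identity and the constant map `x₀`. -/
def cone {x₀ : E} (H : (ContinuousMap.id E).Homotopy (ContinuousMap.const E x₀)) {n : ℕ}
    (s : Simp n E) : Simp (n + 1) E :=
  ⟨coneFun H s, continuous_coneFun H s⟩

/-- The image of a singular simplex under a homeomorphism. -/
def translate (g : E ≃ₜ E) {n : ℕ} (s : Simp n E) : Simp n E :=
  (g : C(E, E)).comp s

/-- The simplices `s̄(g₀, …, g_n)`, with vertices `g₀ x₀, …, g_n x₀`, given by `s̄(g₀) = g₀ x₀` and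
`s̄(g₀, …, g_{n+1}) = g₀ · T_n(g₀⁻¹ · s̄(g₁, …, g_{n+1}))`. -/
def orbitSimplex (p : E → X) {x₀ : E}
    (H : (ContinuousMap.id E).Homotopy (ContinuousMap.const E x₀)) :
    ∀ n : ℕ, (Fin (n + 1) → Deck p) → Simp n E
  | 0, g => ContinuousMap.const _ ((g 0).1 x₀)
  | n + 1, g =>
      translate (g 0).1
        (cone H (translate (g 0).1⁻¹ (orbitSimplex p H n fun i => g i.succ)))

/-! ### The explicit formula -/

/-- The weight `h(g₀⁻¹ s(e₀)) ⋯ h(g_n⁻¹ s(e_n))`. -/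
def weight (p : E → X) (h : E → ℝ) {n : ℕ} (s : Simp n E) (g : Fin (n + 1) → Deck p) : ℝ :=
  ∏ i, h ((g i).1⁻¹ (s (stdSimplex.vertex i)))

/-- The sum `∑ h(g₀⁻¹ s(e₀)) ⋯ h(g_n⁻¹ s(e_n)) φ(s̄(g₀, …, g_n))` over
`(g₀, …, g_n) ∈ Γ^{n+1}`; for a generalized Bruhat function `h` only finitely many of the weights
are nonzero. -/
def thetaTilde (p : E → X) (h : E → ℝ) {x₀ : E}
    (H : (ContinuousMap.id E).Homotopy (ContinuousMap.const E x₀)) {n : ℕ}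
    (φ : Cochain n E) : Cochain n E := fun s =>
  ∑ᶠ g : Fin (n + 1) → Deck p, weight p h s g * φ (orbitSimplex p H n g)

/-- The pull-back `p^*` on cochains. -/
def pullback (p : C(E, X)) {n : ℕ} (φ : Cochain n X) : Cochain n E := fun s => φ (p.comp s)

end ContCohomology

end

open ContCohomology

noncomputable section

namespace ContCohomology

open Set Filter

/-! ### Covering automorphisms of a contractible covering -/

section Covering

open unitInterval

variable {X E : Type*} [TopologicalSpace X] [TopologicalSpace E]

/-! Fix a simplex `s` of `E`. Each tuple of deck transformations gives a simplex spanned by orbit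
points of `x₀`, and an iterated-cone prism joins `s` to it. The values of `h` at the translated
vertices of `s` are product weights of total mass one, so averaging over tuples replaces a cochain
`φ` by `thetaTilde`, which sees `s` only through its vertices and is therefore continuous even when
`φ` is not. As a mean it does not increase the norm.

Averaging the prism identity `prism_coboundary_succ` yields a cochain homotopy from the identity to
`thetaTilde` (`thetaTilde_succ`). Passing to a face matches summing out one group variable, because
the weights at the missing vertex sum to one (`finsum_weight_mul_face`). The homotopy preserves
continuity, by `continuous_cone` and local finiteness, and boundedness, by `enorm_prism_le`.

Every construction is equivariant under deck transformations, so it descends from pull-backs to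
cochains of `X`; continuity descends because lifting simplices has continuous local sections
(`exists_local_section_comp`). The rest is the formal algebra of `HomotopyRetraction`, applied once
to all cochains and once to bounded ones. -/

lemma exists_homotopy_id_const [ContractibleSpace E] (a : E) :
    Nonempty ((ContinuousMap.id E).Homotopy (ContinuousMap.const E a)) := by
  obtain ⟨y, hy⟩ := id_nullhomotopic E
  have h : (ContinuousMap.const E y).Homotopic (ContinuousMap.const E a) :=
    (ContinuousMap.homotopic_const_iff).2 (PathConnectedSpace.joined y a)
  exact hy.trans h

lemma surjective_of_isCoveringMap [PathConnectedSpace X] [Nonempty E] {p : E → X}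
    (hp : IsCoveringMap p) : Function.Surjective p := by
  intro x
  obtain ⟨e⟩ := ‹Nonempty E›
  obtain ⟨γ⟩ := PathConnectedSpace.joined (p e) x
  refine ⟨hp.liftPath γ e γ.source 1, ?_⟩
  exact (congr_fun (hp.liftPath_lifts γ e γ.source) 1).trans γ.target

lemma Deck.eq_of_apply_eq [PreconnectedSpace E] {p : E → X} (hp : IsCoveringMap p)
    {g g' : Deck p} {x : E} (h : g.1 x = g'.1 x) : g = g' :=
  Subtype.ext <| Homeomorph.ext <| congrFun <|
    hp.eq_of_comp_eq g.1.continuous g'.1.continuous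
      (funext fun y => (g.2 y).trans (g'.2 y).symm) x h

/-- In a contractible covering space, the projection lifts to a self-map which takes a given
point to a given point of the same fibre. -/
lemma exists_lift_self [ContractibleSpace E] {p : C(E, X)} (hp : IsCoveringMap p) {a b : E}
    (hab : p a = p b) : ∃ f : C(E, E), (∀ x, p (f x) = p x) ∧ f a = b := by
  obtain ⟨H⟩ := exists_homotopy_id_const a
  -- The contraction run backwards, from the constant `a` to the identity; lifting its projection
  -- from the constant `b` gives the required map at time 1.
  let G : C(I × E, E) := H.symm.toContinuousMap
  have hG0 : ∀ x, G (0, x) = a := fun x => H.symm.apply_zero x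
  have hG1 : ∀ x, G (1, x) = x := fun x => H.symm.apply_one x
  let K : C(I × E, X) := p.comp G
  have hK0 : ∀ x, K (0, x) = p (ContinuousMap.const E b x) := fun x => by
    simp [K, hG0, hab]
  let L := hp.liftHomotopy K (ContinuousMap.const E b) hK0
  refine ⟨L.comp ((ContinuousMap.const E 1).prodMk (ContinuousMap.id E)), fun x => ?_, ?_⟩
  · have := congr_fun (hp.liftHomotopy_lifts K _ hK0) (1, x)
    simpa [K, hG1, L] using this
  -- The track of `a` is a null-homotopic loop, so the lift of its projection starting at `b` also
  -- ends at `b`.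
  · let γ : Path a a := ⟨G.comp ((ContinuousMap.id I).prodMk (ContinuousMap.const I a)),
      hG0 a, hG1 a⟩
    have hγ : γ.Homotopic (Path.refl a) := SimplyConnectedSpace.paths_homotopic _ _
    have hpγ : (p.comp γ.toContinuousMap).HomotopicRel
        (p.comp (Path.refl a).toContinuousMap) {0, 1} := by
      obtain ⟨F⟩ := hγ
      exact ⟨F.compContinuousMap p⟩
    have h1 := hp.liftPath_apply_one_eq_of_homotopicRel hpγ b
      (by simpa using hab) (by simpa using hab)
    have h2 := hp.liftPath_const (x := p a) (e := b) hab
    change hp.liftPath _ _ _ 1 = b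
    refine (h1.trans ?_)
    exact congrArg (fun c : C(I, E) => c 1) h2

/-- The group of covering automorphisms of a contractible covering acts transitively on fibres. -/
lemma exists_deck_apply_eq [ContractibleSpace E] {p : C(E, X)} (hp : IsCoveringMap p) {a b : E}
    (hab : p a = p b) : ∃ g : Deck p, g.1 a = b := by
  obtain ⟨f, hf, hfa⟩ := exists_lift_self hp hab
  obtain ⟨k, hk, hkb⟩ := exists_lift_self hp hab.symm
  have h1 : k ∘ f = id := hp.eq_of_comp_eq (by fun_prop) continuous_id
    (funext fun x => by simp [hf, hk]) a (by simp [hfa, hkb])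
  have h2 : f ∘ k = id := hp.eq_of_comp_eq (by fun_prop) continuous_id
    (funext fun x => by simp [hf, hk]) b (by simp [hfa, hkb])
  exact ⟨⟨⟨⟨f, k, congrFun h1, congrFun h2⟩, f.continuous, k.continuous⟩, hf⟩, hfa⟩

/-! ### Lifting simplices -/

/-- Composition with a surjective covering map admits continuous local sections on spaces of maps
defined on a locally compact contractible space. -/
lemma exists_local_section_comp {D : Type*} [TopologicalSpace D] [LocallyCompactSpace D]
    [ContractibleSpace D] {p : C(E, X)} (hp : IsCoveringMap p) (hsurj : Function.Surjective p)
    (s₀ : C(D, X)) : ∃ U ∈ 𝓝 s₀, ∃ L : U → C(D, E), Continuous L ∧ ∀ s, p.comp (L s) = s.1 := by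
  obtain ⟨v⟩ : Nonempty D := inferInstance
  obtain ⟨H⟩ := exists_homotopy_id_const v
  obtain ⟨e, he⟩ := hsurj (s₀ v)
  obtain ⟨φ, heφ, hφ⟩ := hp.isLocalHomeomorph e
  -- On `U` the lift of `s v` is chosen continuously by `φ.symm`. Contracting `D` to `v` then makes
  -- the remaining lifting a single homotopy lifting problem with parameter space `U × D`.
  let U : Set C(D, X) := {s | s v ∈ φ.target}
  have hU : IsOpen U := φ.open_target.preimage (continuous_eval_const v)
  have hsU : s₀ ∈ U := by
    change s₀ v ∈ φ.target
    rw [← he, hφ]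
    exact φ.map_source heφ
  let K : C(I × (U × D), X) :=
    ⟨fun z => z.2.1.1 (H.symm (z.1, z.2.2)), by fun_prop⟩
  let f : C(U × D, E) := ⟨fun z => φ.symm (z.1.1 v), by
    refine φ.continuousOn_symm.comp_continuous ?_ fun z => z.1.2
    exact (continuous_eval_const v).comp (by fun_prop)⟩
  have h0 : ∀ z, K (0, z) = p (f z) := fun z => by
    have : p (φ.symm (z.1.1 v)) = z.1.1 v := by
      rw [hφ]; exact φ.right_inv z.1.2
    simp [K, f, this]
  let L := (hp.liftHomotopy K f h0).comp
    ((ContinuousMap.const (U × D) 1).prodMk (ContinuousMap.id (U × D)))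
  refine ⟨U, hU.mem_nhds hsU, L.curry, L.curry.continuous, fun s => ?_⟩
  ext d
  have := congr_fun (hp.liftHomotopy_lifts K f h0) (1, (s, d))
  simpa [K, L] using this

instance (n : ℕ) : ContractibleSpace (stdSimplex ℝ (Fin (n + 1))) :=
  (convex_stdSimplex ℝ _).contractibleSpace ⟨_, (stdSimplex.vertex (S := ℝ) (0 : Fin (n + 1))).2⟩

lemma exists_lift_simp {p : C(E, X)} (hp : IsCoveringMap p) (hsurj : Function.Surjective p)
    {n : ℕ} (s : Simp n X) : ∃ s' : Simp n E, p.comp s' = s := by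
  obtain ⟨U, hU, L, -, hL⟩ := exists_local_section_comp hp hsurj s
  exact ⟨L ⟨s, mem_of_mem_nhds hU⟩, hL _⟩

lemma comp_translate {p : C(E, X)} (g : Deck p) {n : ℕ} (s : Simp n E) :
    p.comp (translate g.1 s) = p.comp s := by
  ext q
  exact g.2 (s q)

/-- Transitivity on fibres matches the two lifts at one vertex; lifts from a connected simplex that
agree at a point are equal. -/
lemma exists_translate_eq [ContractibleSpace E] {p : C(E, X)} (hp : IsCoveringMap p) {n : ℕ}
    {s s' : Simp n E} (h : p.comp s = p.comp s') : ∃ g : Deck p, translate g.1 s = s' := by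
  let v : stdSimplex ℝ (Fin (n + 1)) := stdSimplex.vertex 0
  obtain ⟨g, hg⟩ := exists_deck_apply_eq hp (a := s v) (b := s' v) (congrArg (fun f => f v) h)
  refine ⟨g, DFunLike.coe_injective ?_⟩
  refine hp.eq_of_comp_eq (translate g.1 s).continuous s'.continuous ?_ v hg
  have : p.comp (translate g.1 s) = p.comp s' := (comp_translate g s).trans h
  exact congrArg (fun f : Simp n X => (f : _ → X)) this

/-- A cochain of the base is continuous as soon as its pull-back is. -/
lemma continuous_of_continuous_pullback {p : C(E, X)} (hp : IsCoveringMap p)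
    (hsurj : Function.Surjective p) {n : ℕ} {φ : Cochain n X}
    (h : Continuous (pullback p φ)) : Continuous φ := by
  rw [continuous_iff_continuousAt]
  intro s
  obtain ⟨U, hU, L, hLc, hL⟩ := exists_local_section_comp hp hsurj s
  refine ContinuousOn.continuousAt ?_ hU
  rw [continuousOn_iff_continuous_domRestrict]
  convert h.comp hLc using 1
  funext t
  simp [pullback, hL]

/-- The cochain of the base whose value on `s` is the value of the given cochain on some lift
of `s`. -/
def descend (p : C(E, X)) {n : ℕ} (ψ : Cochain n E) : Cochain n X := fun s =>
  open Classical in if h : ∃ s' : Simp n E, p.comp s' = s then ψ h.choose else 0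

lemma descend_comp [ContractibleSpace E] {p : C(E, X)} (hp : IsCoveringMap p) {n : ℕ}
    {ψ : Cochain n E} (hψ : ∀ (g : Deck p) s, ψ (translate g.1 s) = ψ s) (s : Simp n E) :
    descend p ψ (p.comp s) = ψ s := by
  have h : ∃ s' : Simp n E, p.comp s' = p.comp s := ⟨s, rfl⟩
  rw [descend, dif_pos h]
  obtain ⟨g, hg⟩ := exists_translate_eq hp h.choose_spec
  exact (hψ g _).symm.trans (congrArg ψ hg)

end Covering

/-! ### Existence of generalized Bruhat functions -/

section Bruhat

variable {X E : Type*} [TopologicalSpace X] [TopologicalSpace E]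

/-- Generalized Bruhat functions exist: sum the pull-backs of the functions of a partition of unity
subordinate to a cover by evenly covered sets, each restricted to a single sheet. -/
theorem exists_isBruhat [PathConnectedSpace X] [T2Space X] [ParacompactSpace X]
    [ContractibleSpace E] {p : C(E, X)} (hp : IsCoveringMap p) : ∃ h, IsBruhat p h := by
  have hsurj := surjective_of_isCoveringMap hp
  choose e he using hsurj
  choose φ heφ hφ using fun x => hp.isLocalHomeomorph (e x)
  have hinj : ∀ i a b, a ∈ (φ i).source → b ∈ (φ i).source → p a = p b → a = b :=
    fun i a b ha hb hab => (φ i).injOn ha hb (by rw [← hφ]; exact hab)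
  -- With `huniq`: over the target of `φ i`, exactly one translate of each point lies in the chosen
  -- sheet.
  have hsheet : ∀ i a, p a ∈ (φ i).target → ∃ g : Deck p, g.1 a ∈ (φ i).source := by
    intro i a ha
    have h1 : p ((φ i).symm (p a)) = p a := by
      rw [hφ i]; exact (φ i).right_inv (by rw [← hφ i]; exact ha)
    obtain ⟨g, hg⟩ := exists_deck_apply_eq hp h1.symm
    exact ⟨g, hg ▸ (φ i).map_target ha⟩
  have huniq : ∀ i a (g g' : Deck p), g.1 a ∈ (φ i).source → g'.1 a ∈ (φ i).source → g = g' :=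
    fun i a g g' h h' => Deck.eq_of_apply_eq hp
      (hinj i _ _ h h' ((g.2 a).trans (g'.2 a).symm))
  obtain ⟨ρ, hρ⟩ := PartitionOfUnity.exists_isSubordinate (X := X) isClosed_univ
    (fun i => (φ i).target) (fun i => (φ i).open_target) (fun x _ => mem_iUnion.2 ⟨x, by
      simpa only [← hφ x, he x] using (φ x).map_source (heφ x)⟩)
  let f : X → E → ℝ := fun i => (φ i).source.indicator fun a => ρ i (p a)
  have hf0 : ∀ i a, 0 ≤ f i a := fun i a => indicator_nonneg (fun _ _ => ρ.nonneg _ _) _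
  have hfne : ∀ {i a}, f i a ≠ 0 → a ∈ (φ i).source ∧ ρ i (p a) ≠ 0 := fun {i a} h =>
    ⟨mem_of_indicator_ne_zero h, fun h0 => h (by simp [f, h0])⟩
  have hfcont : ∀ i, Continuous (f i) := by
    intro i
    rw [continuous_iff_continuousAt]
    intro a
    -- Over the support, a single `g` carries a neighbourhood of `a` into the sheet. If `g = 1` then
    -- `f i` is `ρ i ∘ p` there; otherwise the neighbourhood misses the sheet and `f i` vanishes.
    by_cases ha : p a ∈ tsupport (ρ i)
    · obtain ⟨g, hg⟩ := hsheet i a (hρ i ha)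
      have hW : g.1 ⁻¹' (φ i).source ∈ 𝓝 a :=
        ((φ i).open_source.preimage g.1.continuous).mem_nhds hg
      by_cases hg1 : g = 1
      · subst hg1
        refine ContinuousAt.congr (f := fun a => ρ i (p a)) (by fun_prop) ?_
        filter_upwards [hW] with b hb
        exact (indicator_of_mem (s := (φ i).source) (by simpa using hb) fun a => ρ i (p a)).symm
      · refine ContinuousAt.congr (f := fun _ => 0) continuousAt_const ?_
        filter_upwards [hW] with b hb
        exact (indicator_of_notMem (fun hb' => hg1 (huniq i b g 1 hb hb')) _).symm
    · refine ContinuousAt.congr (f := fun _ => 0) continuousAt_const ?_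
      have hW : p ⁻¹' (tsupport (ρ i))ᶜ ∈ 𝓝 a :=
        ((isClosed_tsupport _).isOpen_compl.preimage p.continuous).mem_nhds ha
      filter_upwards [hW] with b hb
      refine (indicator_apply_eq_zero.2 fun _ => ?_).symm
      exact image_eq_zero_of_notMem_tsupport hb
  have hflf : LocallyFinite fun i => Function.support (f i) :=
    (ρ.locallyFinite.preimage_continuous p.continuous).subset fun i a ha => (hfne ha).2
  have hfin : ∀ a, (Function.support fun i => f i a).Finite := fun a => hflf.point_finite a
  have hsum : ∀ a, ∑ᶠ i, f i a = ∑ i ∈ ρ.finsupport (p a), f i a := fun a =>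
    finsum_eq_finsetSum_of_support_subset _ fun i hi => by
      simpa [ρ.mem_finsupport] using (hfne hi).2
  have hle : ∀ a, ∑ᶠ i, f i a ≤ 1 := by
    intro a
    rw [hsum, ← ρ.sum_finsupport (mem_univ (p a))]
    exact Finset.sum_le_sum fun i _ =>
      indicator_apply_le' (fun _ => le_rfl) fun _ => ρ.nonneg _ _
  refine ⟨fun a => ∑ᶠ i, f i a, continuous_finsum hfcont hflf,
    fun a => ⟨finsum_nonneg fun i => hf0 i a, hle a⟩, fun a => ?_, fun a => ?_⟩
  -- Near `a` only the finitely many indices in `ρ.fintsupport (p a)` matter, and each admits only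
  -- one deck transformation.
  · have hg : ∀ i : ρ.fintsupport (p a), ∃ g : Deck p, g.1 a ∈ (φ i).source := fun i =>
      hsheet i a (hρ _ ((ρ.mem_fintsupport_iff _ _).1 i.2))
    choose g hg using hg
    have hW : ∀ᶠ b in 𝓝 a, ρ.fintsupport (p b) ⊆ ρ.fintsupport (p a) ∧
        ∀ i : ρ.fintsupport (p a), (g i).1 b ∈ (φ i).source := by
      refine (p.continuous.continuousAt.eventually (ρ.eventually_fintsupport_subset (p a))).and
        (eventually_all.2 fun i => ?_)
      exact ((φ i).open_source.preimage (g i).1.continuous).mem_nhds (hg i)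
    obtain ⟨W, hWs, hWo, haW⟩ := mem_nhds_iff.1 hW
    refine ⟨W, hWo.mem_nhds haW, (finite_range g).subset ?_⟩
    rintro k ⟨c, hcW, hct⟩
    -- Since `k '' W` is open, meeting the closed support forces it to meet the set where the sum is
    -- nonzero.
    obtain ⟨c', hcW', hct'⟩ := mem_closure_iff.1 hct _ (k.1.isOpenMap _ hWo) hcW
    obtain ⟨b, hb, rfl⟩ := hcW'
    obtain ⟨i, hi⟩ : ∃ i, f i (k.1 b) ≠ 0 := by
      by_contra! h0
      exact hct' (finsum_eq_zero_of_forall_eq_zero h0)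
    obtain ⟨hi1, hi2⟩ := hfne hi
    have hpk : p (k.1 b) = p b := k.2 b
    rw [hpk] at hi2
    have hi3 : i ∈ ρ.fintsupport (p a) := (hWs hb).1
      (ρ.finsupport_subset_fintsupport _ ((ρ.mem_finsupport _).2 hi2))
    exact ⟨⟨i, hi3⟩, huniq i b _ _ ((hWs hb).2 ⟨i, hi3⟩) hi1⟩
  · have hg : ∀ i ∈ ρ.finsupport (p a), ∃ g : Deck p, g.1 a ∈ (φ i).source := fun i hi =>
      hsheet i a (hρ _ (subset_closure ((ρ.mem_finsupport _).1 hi)))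
    have hpg : ∀ g : Deck p, p (g.1 a) = p a := fun g => g.2 a
    have h1 : ∀ i ∈ ρ.finsupport (p a), ∃ g : Deck p, f i (g.1 a) = ρ i (p a) ∧
        ∀ g', g' ≠ g → f i (g'.1 a) = 0 := by
      intro i hi
      obtain ⟨g, hg⟩ := hg i hi
      refine ⟨g, ?_, fun g' hg' => indicator_of_notMem (fun h => hg' (huniq i a _ _ h hg)) _⟩
      rw [← hpg g]
      exact indicator_of_mem (s := (φ i).source) (by simpa using hg) fun a => ρ i (p a)
    simp_rw [hsum, hpg]
    rw [finsum_sum_comm]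
    · rw [← ρ.sum_finsupport (mem_univ (p a))]
      refine Finset.sum_congr rfl fun i hi => ?_
      obtain ⟨g, hg, hg'⟩ := h1 i hi
      rw [finsum_eq_single _ g hg', hg]
    · intro i hi
      obtain ⟨g, hg, hg'⟩ := h1 i hi
      refine (finite_singleton g).subset fun g' h => ?_
      by_contra hne
      exact h (hg' g' hne)

end Bruhat

/-! ### Sums weighted by products -/

section ProductWeights

variable {G : Type*}

lemma finite_support_prod {n : ℕ} {u : Fin n → G → ℝ} (hu : ∀ i, (Function.support (u i)).Finite) :
    (Function.support fun g : Fin n → G => ∏ i, u i (g i)).Finite :=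
  (Finite.pi hu).subset fun _ hg i _ h0 => hg (Finset.prod_eq_zero (Finset.mem_univ i) h0)

lemma finite_support_prod_mul {n : ℕ} {u : Fin n → G → ℝ}
    (hu : ∀ i, (Function.support (u i)).Finite) (f : (Fin n → G) → ℝ) :
    (Function.support fun g : Fin n → G => (∏ i, u i (g i)) * f g).Finite :=
  (finite_support_prod hu).subset fun _ hg h0 => hg (by simp only [h0, zero_mul])

/-- Summing out one variable, on which the summand depends only through a weight of total
mass one. -/
lemma finsum_prod_mul_removeNth {n : ℕ} {u : Fin (n + 1) → G → ℝ}
    (hu : ∀ i, (Function.support (u i)).Finite) (i : Fin (n + 1)) (hi : ∑ᶠ g, u i g = 1)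
    (f : (Fin n → G) → ℝ) :
    ∑ᶠ g : Fin (n + 1) → G, (∏ j, u j (g j)) * f (fun j => g (i.succAbove j)) =
      ∑ᶠ g : Fin n → G, (∏ j, u (i.succAbove j) (g j)) * f g := by
  have hfin := finite_support_prod_mul hu fun g => f fun j => g (i.succAbove j)
  -- Fubini, with the variable `i` split off as the inner sum; finite support justifies the
  -- exchange.
  rw [← finsum_comp_equiv (Fin.insertNthEquiv (fun _ => G) i),
    finsum_curry _ (hfin.preimage (Equiv.injective _).injOn)]
  simp only [Fin.insertNthEquiv_apply, Fin.prod_univ_succAbove _ i, Fin.insertNth_apply_same,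
    Fin.insertNth_apply_succAbove, mul_assoc]
  simp_rw [← mul_finsum, ← finsum_mul, hi, one_mul]

lemma finsum_prod_eq_one : ∀ {n : ℕ} {u : Fin n → G → ℝ}
    (_ : ∀ i, (Function.support (u i)).Finite) (_ : ∀ i, ∑ᶠ g, u i g = 1),
    ∑ᶠ g : Fin n → G, ∏ i, u i (g i) = 1
  | 0, u, _, _ => by simp [finsum_unique]
  | n + 1, u, hu, h1 => by
    have h := finsum_prod_mul_removeNth hu 0 (h1 0) fun _ => 1
    simp only [mul_one] at h
    rw [h]
    exact finsum_prod_eq_one (fun i => hu _) fun i => h1 _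

/-- A weighted mean of numbers of size at most `C` has size at most `C`. -/
lemma enorm_finsum_prod_mul_le {n : ℕ} {u : Fin n → G → ℝ} (h0 : ∀ i g, 0 ≤ u i g)
    (hu : ∀ i, (Function.support (u i)).Finite) (h1 : ∀ i, ∑ᶠ g, u i g = 1)
    {f : (Fin n → G) → ℝ} {C : ℝ≥0∞} (hf : ∀ g, ‖f g‖ₑ ≤ C) :
    ‖∑ᶠ g : Fin n → G, (∏ i, u i (g i)) * f g‖ₑ ≤ C := by
  rcases eq_or_ne C ⊤ with rfl | hC
  · exact le_top
  have hf' : ∀ g, |f g| ≤ C.toReal := fun g => by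
    have := ENNReal.toReal_mono hC (hf g)
    rwa [toReal_enorm, Real.norm_eq_abs] at this
  have hfin := finite_support_prod_mul hu f
  have hw := finsum_prod_eq_one hu h1
  rw [finsum_eq_finsetSum_of_support_subset (s := (finite_support_prod hu).toFinset)] at hw ⊢
  · rw [← ofReal_norm, Real.norm_eq_abs]
    refine ENNReal.ofReal_le_of_le_toReal ?_
    refine (Finset.abs_sum_le_sum_abs _ _).trans ?_
    calc _ ≤ ∑ g ∈ (finite_support_prod hu).toFinset, (∏ i, u i (g i)) * C.toReal := by
          refine Finset.sum_le_sum fun g _ => ?_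
          have hp : 0 ≤ ∏ i, u i (g i) := Finset.prod_nonneg fun i _ => h0 i _
          rw [abs_mul, abs_of_nonneg hp]
          exact mul_le_mul_of_nonneg_left (hf' g) hp
      _ = C.toReal := by rw [← Finset.sum_mul, hw, one_mul]
  · simp
  · intro g hg
    simp only [Finite.coe_toFinset]
    exact fun h => hg (by simp only [h])

end ProductWeights

/-! ### Weights given by a generalized Bruhat function -/

section Weight

variable {X E : Type*} [TopologicalSpace E] {p : E → X} {h : E → ℝ}

namespace IsBruhat

lemma finite_support_inv (hh : IsBruhat p h) (x : E) :
    (Function.support fun g : Deck p => h (g.1⁻¹ x)).Finite := by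
  obtain ⟨W, hW, hfin⟩ := hh.locally_finite x
  refine (hfin.preimage (f := fun g : Deck p => g⁻¹) inv_injective.injOn).subset fun g hg => ?_
  exact ⟨_, mem_image_of_mem _ (mem_of_mem_nhds hW), subset_tsupport _ hg⟩

lemma finsum_inv_eq_one (hh : IsBruhat p h) (x : E) : ∑ᶠ g : Deck p, h (g.1⁻¹ x) = 1 := by
  rw [← hh.sum_eq_one x]
  exact finsum_comp_equiv (Equiv.inv (Deck p)) (f := fun g => h (g.1 x))

lemma finite_support_weight (hh : IsBruhat p h) {n : ℕ} (s : Simp n E) :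
    (Function.support (weight p h s)).Finite :=
  finite_support_prod fun _ => hh.finite_support_inv _

lemma finite_support_weight_mul (hh : IsBruhat p h) {n : ℕ} (s : Simp n E)
    (f : (Fin (n + 1) → Deck p) → ℝ) :
    (Function.support fun g => weight p h s g * f g).Finite :=
  finite_support_prod_mul (fun _ => hh.finite_support_inv _) f

lemma finsum_weight (hh : IsBruhat p h) {n : ℕ} (s : Simp n E) : ∑ᶠ g, weight p h s g = 1 :=
  finsum_prod_eq_one (fun _ => hh.finite_support_inv _) fun _ => hh.finsum_inv_eq_one _

lemma enorm_finsum_weight_mul_le (hh : IsBruhat p h) {n : ℕ} (s : Simp n E)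
    {f : (Fin (n + 1) → Deck p) → ℝ} {C : ℝ≥0∞} (hf : ∀ g, ‖f g‖ₑ ≤ C) :
    ‖∑ᶠ g, weight p h s g * f g‖ₑ ≤ C :=
  enorm_finsum_prod_mul_le (fun _ _ => (hh.mem_Icc _).1) (fun _ => hh.finite_support_inv _)
    (fun _ => hh.finsum_inv_eq_one _) hf

/-- The face keeps every vertex of `s` but the `i`-th, whose weights add up to one. This makes
averaging compatible with coboundaries. -/
lemma finsum_weight_mul_face (hh : IsBruhat p h) {n : ℕ} (s : Simp (n + 1) E) (i : Fin (n + 2))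
    (f : (Fin (n + 1) → Deck p) → ℝ) :
    ∑ᶠ g : Fin (n + 2) → Deck p, weight p h s g * f (fun j => g (i.succAbove j)) =
      ∑ᶠ g, weight p h (s.comp (faceIncl n i)) g * f g := by
  have := finsum_prod_mul_removeNth
    (u := fun (j : Fin (n + 2)) (g : Deck p) => h (g.1⁻¹ (s (stdSimplex.vertex j))))
    (fun _ => hh.finite_support_inv _) i (hh.finsum_inv_eq_one _) f
  refine this.trans (finsum_congr fun g => ?_)
  simp [weight, faceIncl]

/-- Weighted sums of continuous cochains are continuous. -/
lemma continuous_finsum_weight_mul (hh : IsBruhat p h) {n : ℕ}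
    {f : (Fin (n + 1) → Deck p) → Simp n E → ℝ} (hf : ∀ g, Continuous (f g)) :
    Continuous fun s : Simp n E => ∑ᶠ g, weight p h s g * f g s := by
  refine continuous_finsum (fun g => ?_) fun s => ?_
  · refine Continuous.mul ?_ (hf g)
    refine continuous_finsetProd _ fun i _ => hh.continuous.comp ?_
    exact (Homeomorph.continuous _).comp (continuous_eval_const _)
  · choose W hW hfin using fun i : Fin (n + 1) => hh.locally_finite (s (stdSimplex.vertex i))
    refine ⟨⋂ i, {t : Simp n E | t (stdSimplex.vertex i) ∈ W i}, ?_, ?_⟩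
    · exact iInter_mem.2 fun i => (continuous_eval_const _).continuousAt.preimage_mem_nhds (hW i)
    · refine (Finite.pi fun i => (hfin i).preimage (f := fun g : Deck p => g⁻¹)
        inv_injective.injOn).subset ?_
      rintro g ⟨t, ht, htW⟩ i -
      refine ⟨_, mem_image_of_mem _ (mem_iInter.1 htW i), subset_tsupport _ fun h0 => ht ?_⟩
      change weight p h t g * _ = 0
      rw [weight, Finset.prod_eq_zero (Finset.mem_univ i) h0, zero_mul]

end IsBruhat

lemma weight_translate (γ : Deck p) {n : ℕ} (s : Simp n E) (g : Fin (n + 1) → Deck p) :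
    weight p h (translate γ.1 s) (fun i => γ * g i) = weight p h s g := by
  refine Finset.prod_congr rfl fun i _ => congrArg h ?_
  change ((γ.1 * (g i).1)⁻¹ * γ.1) _ = _
  simp [mul_assoc]

lemma finsum_weight_translate (γ : Deck p) {n : ℕ} (s : Simp n E)
    (f : (Fin (n + 1) → Deck p) → ℝ) :
    ∑ᶠ g, weight p h (translate γ.1 s) g * f g =
      ∑ᶠ g, weight p h s g * f (fun i => γ * g i) := by
  rw [← finsum_comp_equiv (Equiv.arrowCongr (Equiv.refl (Fin (n + 1))) (Equiv.mulLeft γ))]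
  refine finsum_congr fun g => ?_
  rw [← weight_translate γ s g]
  rfl

end Weight

/-! ### Faces -/

section Faces

variable {X : Type*} [TopologicalSpace X]

lemma map_succAbove_apply_self {n : ℕ} (i : Fin (n + 2)) (t : stdSimplex ℝ (Fin (n + 1))) :
    stdSimplex.map i.succAbove t i = 0 := by
  rw [stdSimplex.map_coe, FunOnFinite.linearMap_apply_apply]
  refine Finset.sum_eq_zero fun x hx => ?_
  simp at hx

lemma map_succAbove_apply_succAbove {n : ℕ} (i : Fin (n + 2)) (j : Fin (n + 1))
    (t : stdSimplex ℝ (Fin (n + 1))) :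
    stdSimplex.map i.succAbove t (i.succAbove j) = t j := by
  rw [stdSimplex.map_coe, FunOnFinite.linearMap_apply_apply]
  simp [Finset.sum_filter]

/-- Both sides omit the same two vertices, in opposite orders. In this form the simplicial identity
is an involution on pairs `(i, j)`, with no case split on their order. -/
lemma face_face {n : ℕ} (s : Simp (n + 2) X) (i : Fin (n + 3)) (j : Fin (n + 2)) :
    (s.comp (faceIncl (n + 1) i)).comp (faceIncl n j) =
      (s.comp (faceIncl (n + 1) (i.succAbove j))).comp (faceIncl n (j.predAbove i)) := by
  ext t
  change s (stdSimplex.map _ (stdSimplex.map _ t)) = s (stdSimplex.map _ (stdSimplex.map _ t))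
  rw [stdSimplex.map_comp_apply, stdSimplex.map_comp_apply]
  congr 2
  funext k
  exact (Fin.succAbove_succAbove_succAbove_predAbove i j k).symm

lemma face_succ_face_zero {n : ℕ} (s : Simp (n + 2) X) (j : Fin (n + 2)) :
    (s.comp (faceIncl (n + 1) j.succ)).comp (faceIncl n 0) =
      (s.comp (faceIncl (n + 1) 0)).comp (faceIncl n j) := by
  rw [face_face s j.succ 0]
  simp

lemma coboundary_apply {n : ℕ} (φ : Cochain n X) (s : Simp (n + 1) X) :
    coboundary n φ s = ∑ i : Fin (n + 2), (-1 : ℝ) ^ (i : ℕ) * φ (s.comp (faceIncl n i)) := rfl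

lemma coboundary_coboundary {n : ℕ} (φ : Cochain n X) :
    coboundary (n + 1) (coboundary n φ) = 0 := by
  funext s
  simp only [coboundary_apply, Finset.mul_sum, Pi.zero_apply, ← mul_assoc, ← pow_add]
  rw [← Finset.sum_product']
  refine Finset.sum_involution (fun z _ => (z.1.succAbove z.2, z.2.predAbove z.1)) ?_ ?_ ?_ ?_
  · rintro ⟨i, j⟩ -
    have := Fin.neg_one_pow_succAbove_add_predAbove (R := ℝ) i j
    simp only [this]
    rw [face_face s i j]
    ring
  · rintro ⟨i, j⟩ - - h
    exact Fin.succAbove_ne i j (congrArg Prod.fst h)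
  · simp
  · rintro ⟨i, j⟩ -
    simp [Fin.succAbove_succAbove_predAbove, Fin.predAbove_predAbove_succAbove]

end Faces

/-! ### Cones -/

section Cone

variable {X E : Type*} [TopologicalSpace E] {x₀ : E}
  (H : (ContinuousMap.id E).Homotopy (ContinuousMap.const E x₀))

lemma cone_face_zero {n : ℕ} (s : Simp n E) : (cone H s).comp (faceIncl n 0) = s := by
  ext t
  have h0 : (faceIncl n 0 t) 0 = 0 := map_succAbove_apply_self 0 t
  have h1 : (faceIncl n 0 t) 0 ≠ 1 := by rw [h0]; exact zero_ne_one
  change coneFun H s (faceIncl n 0 t) = s t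
  rw [coneFun, dif_neg h1]
  have h2 : proj0 (faceIncl n 0 t) h1 = t := by
    refine stdSimplex.ext (funext fun i => ?_)
    change (faceIncl n 0 t) i.succ / (1 - (faceIncl n 0 t) 0) = t i
    rw [h0, sub_zero, div_one]
    exact map_succAbove_apply_succAbove 0 i t
  have h3 : (⟨(faceIncl n 0 t) 0, stdSimplex.zero_le _ 0, stdSimplex.le_one _ 0⟩ :
      unitInterval) = 0 := Subtype.ext h0
  rw [h2, h3, H.apply_zero]
  rfl

/-- Omitting a vertex other than the apex leaves the time coordinate `t 0` alone and commutes with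
projection from the apex. -/
lemma cone_face_succ {n : ℕ} (s : Simp (n + 1) E) (i : Fin (n + 2)) :
    (cone H s).comp (faceIncl (n + 1) i.succ) = cone H (s.comp (faceIncl n i)) := by
  ext t
  have h0 : (faceIncl (n + 1) i.succ t) 0 = t 0 := by
    have := map_succAbove_apply_succAbove i.succ 0 t
    rwa [Fin.succ_succAbove_zero] at this
  change coneFun H s (faceIncl (n + 1) i.succ t) = coneFun H (s.comp (faceIncl n i)) t
  by_cases ht : t 0 = 1
  · rw [coneFun, dif_pos (h0.trans ht), coneFun, dif_pos ht]
  · have ht' : (faceIncl (n + 1) i.succ t) 0 ≠ 1 := h0 ▸ ht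
    rw [coneFun, dif_neg ht', coneFun, dif_neg ht]
    have h2 : proj0 (faceIncl (n + 1) i.succ t) ht' = faceIncl n i (proj0 t ht) := by
      refine stdSimplex.ext (funext fun k => ?_)
      change (faceIncl (n + 1) i.succ t) k.succ / (1 - (faceIncl (n + 1) i.succ t) 0) =
        stdSimplex.map i.succAbove (proj0 t ht) k
      rw [h0]
      rcases eq_or_ne k i with rfl | hk
      · rw [map_succAbove_apply_self]
        have : (faceIncl (n + 1) k.succ t) k.succ = 0 := map_succAbove_apply_self k.succ t
        rw [this, zero_div]
      · obtain ⟨j, rfl⟩ := Fin.exists_succAbove_eq hk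
        rw [map_succAbove_apply_succAbove]
        have : (faceIncl (n + 1) i.succ t) (i.succAbove j).succ = t j.succ := by
          rw [← Fin.succ_succAbove_succ]
          exact map_succAbove_apply_succAbove i.succ j.succ t
        rw [this]
        rfl
    have h3 : (⟨(faceIncl (n + 1) i.succ t) 0, stdSimplex.zero_le _ 0, stdSimplex.le_one _ 0⟩ :
        unitInterval) = ⟨t 0, stdSimplex.zero_le _ 0, stdSimplex.le_one _ 0⟩ := Subtype.ext h0
    rw [h2, h3]
    rfl

lemma cone_face_one (s : Simp 0 E) :
    (cone H s).comp (faceIncl 0 1) = ContinuousMap.const _ x₀ := by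
  ext t
  have h0 : (faceIncl 0 1 t) 0 = 1 := by
    have h := stdSimplex.sum_eq_one (faceIncl 0 1 t)
    have h1 : (faceIncl 0 1 t) 1 = 0 := map_succAbove_apply_self 1 t
    rwa [Fin.sum_univ_two, h1, add_zero] at h
  change coneFun H s (faceIncl 0 1 t) = x₀
  rw [coneFun, dif_pos h0]

/-- Taking cones is continuous for the compact-open topologies. -/
lemma continuous_cone {n : ℕ} : Continuous fun s : Simp n E => cone H s := by
  refine ContinuousMap.continuous_of_continuous_uncurry _ ?_
  change Continuous fun z : Simp n E × stdSimplex ℝ (Fin (n + 2)) => coneFun H z.1 z.2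
  have hc : ∀ i : Fin (n + 2), Continuous fun t : stdSimplex ℝ (Fin (n + 2)) => t i := fun i =>
    (continuous_apply i).comp continuous_subtype_val
  have hcu : Continuous fun z : Simp n E × stdSimplex ℝ (Fin (n + 2)) =>
      (⟨z.2 0, stdSimplex.zero_le z.2 0, stdSimplex.le_one z.2 0⟩ : unitInterval) :=
    ((hc 0).comp continuous_snd).subtype_mk _
  rw [continuous_iff_continuousAt]
  rintro ⟨s, t⟩
  by_cases ht : t 0 = 1
  · rw [ContinuousAt, show coneFun H s t = x₀ from dif_pos ht, tendsto_nhds]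
    intro U hU hxU
    -- `proj0` has no limit at the apex, but the image of `s` is compact: `H` sends all of a
    -- neighbourhood `v` of it into `U` for times near 1, and nearby simplices stay in `v`.
    obtain ⟨u, v, hu, hv, hsu, hsv, huv⟩ := generalized_tube_lemma
      (isCompact_singleton (x := (1 : unitInterval))) (isCompact_range s.continuous)
      (hU.preimage H.continuous) (by
        rintro ⟨a, b⟩ ⟨ha, -⟩
        obtain rfl : a = 1 := ha
        have hab : H (1, b) = x₀ := by simp
        simpa [hab] using hxU)
    have h1 : (⟨t 0, stdSimplex.zero_le t 0, stdSimplex.le_one t 0⟩ : unitInterval) ∈ u :=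
      hsu (Subtype.ext ht)
    have h2 : ∀ᶠ z : Simp n E × stdSimplex ℝ (Fin (n + 2)) in 𝓝 (s, t), MapsTo z.1 univ v :=
      continuous_fst.continuousAt.eventually
        (ContinuousMap.eventually_mapsTo isCompact_univ hv fun x _ => hsv (mem_range_self x))
    filter_upwards [hcu.continuousAt.preimage_mem_nhds (hu.mem_nhds h1), h2] with z hz1 hz2
    change coneFun H z.1 z.2 ∈ U
    by_cases h3 : z.2 0 = 1
    · rwa [coneFun, dif_pos h3]
    · rw [coneFun, dif_neg h3]
      exact huv (mk_mem_prod hz1 (hz2 (mem_univ _)))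
  · have ho : IsOpen {z : Simp n E × stdSimplex ℝ (Fin (n + 2)) | z.2 0 ≠ 1} :=
      isOpen_ne.preimage ((hc 0).comp continuous_snd)
    refine ContinuousOn.continuousAt ?_ (ho.mem_nhds ht)
    rw [continuousOn_iff_continuous_domRestrict]
    have he : Set.domRestrict {z : Simp n E × stdSimplex ℝ (Fin (n + 2)) | z.2 0 ≠ 1}
        (fun z => coneFun H z.1 z.2) = fun z =>
        H (⟨z.1.2 0, stdSimplex.zero_le z.1.2 0, stdSimplex.le_one z.1.2 0⟩,
          z.1.1 (proj0 z.1.2 z.2)) := by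
      funext z
      exact dif_neg z.2
    rw [he]
    have hproj : Continuous fun z : {z : Simp n E × stdSimplex ℝ (Fin (n + 2)) | z.2 0 ≠ 1} =>
        proj0 z.1.2 z.2 := by
      refine Continuous.subtype_mk (continuous_pi fun i => ?_) _
      have hz : Continuous fun z : {z : Simp n E × stdSimplex ℝ (Fin (n + 2)) | z.2 0 ≠ 1} =>
          z.1.2 := continuous_snd.comp continuous_subtype_val
      exact ((hc i.succ).comp hz).div (continuous_const.sub ((hc 0).comp hz))
        fun z => sub_ne_zero.2 (Ne.symm z.2)
    refine H.continuous.comp ((hcu.comp continuous_subtype_val).prodMk ?_)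
    have hs : Continuous fun z : {z : Simp n E × stdSimplex ℝ (Fin (n + 2)) | z.2 0 ≠ 1} =>
        z.1.1 := continuous_fst.comp continuous_subtype_val
    exact continuous_eval.comp (hs.prodMk hproj)

lemma continuous_translate (g : E ≃ₜ E) {n : ℕ} :
    Continuous fun s : Simp n E => translate g s :=
  ContinuousMap.continuous_postcomp _

lemma translate_translate (a b : E ≃ₜ E) {n : ℕ} (s : Simp n E) :
    translate a (translate b s) = translate (a * b) s := rfl

lemma translate_one {n : ℕ} (s : Simp n E) : translate 1 s = s := rfl

variable {p : E → X}

lemma orbitSimplex_mul (γ : Deck p) : ∀ {n : ℕ} (g : Fin (n + 1) → Deck p),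
    orbitSimplex p H n (fun i => γ * g i) = translate γ.1 (orbitSimplex p H n g)
  | 0, _ => rfl
  | n + 1, g => by
    rw [orbitSimplex, orbitSimplex, orbitSimplex_mul γ fun i => g i.succ]
    simp only [translate_translate, Subgroup.coe_mul, mul_inv_rev, mul_assoc, inv_mul_cancel,
      mul_one]

/-- The dual of the operator which takes the cone with vertex `g x₀`. -/
def coneCochain (g : Deck p) {n : ℕ} (φ : Cochain (n + 1) E) : Cochain n E := fun s =>
  φ (translate g.1 (cone H (translate g.1⁻¹ s)))

lemma coneCochain_coboundary_zero (g : Deck p) (φ : Cochain 0 E) (s : Simp 0 E) :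
    coneCochain H g (coboundary 0 φ) s = φ s - φ (ContinuousMap.const _ (g.1 x₀)) := by
  have h : ∀ i, (translate g.1 (cone H (translate g.1⁻¹ s))).comp (faceIncl 0 i) =
      translate g.1 ((cone H (translate g.1⁻¹ s)).comp (faceIncl 0 i)) := fun _ => rfl
  rw [coneCochain, coboundary_apply, Fin.sum_univ_two, h, h, cone_face_zero, cone_face_one,
    translate_translate, mul_inv_cancel, translate_one]
  simp [translate, sub_eq_add_neg, ContinuousMap.comp_const]

/-- The zeroth face of the cone is `s`; the others are cones over faces of `s` with index shifted by
one, hence the sign. -/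
lemma coneCochain_coboundary (g : Deck p) {n : ℕ} (φ : Cochain (n + 1) E)
    (s : Simp (n + 1) E) :
    coneCochain H g (coboundary (n + 1) φ) s = φ s - coboundary n (coneCochain H g φ) s := by
  have h : ∀ i, (translate g.1 (cone H (translate g.1⁻¹ s))).comp (faceIncl (n + 1) i) =
      translate g.1 ((cone H (translate g.1⁻¹ s)).comp (faceIncl (n + 1) i)) := fun _ => rfl
  rw [coneCochain, coboundary_apply, Fin.sum_univ_succ, coboundary_apply, sub_eq_add_neg,
    ← Finset.sum_neg_distrib, h, cone_face_zero, translate_translate, mul_inv_cancel,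
    translate_one]
  simp only [Fin.val_zero, pow_zero, one_mul, h, cone_face_succ, Fin.val_succ, pow_succ]
  congr 1
  refine Finset.sum_congr rfl fun i _ => ?_
  simp only [coneCochain, translate, ContinuousMap.comp_assoc]
  ring

lemma coneCochain_translate (γ g : Deck p) {n : ℕ} (φ : Cochain (n + 1) E) (s : Simp n E) :
    coneCochain H (γ * g) φ (translate γ.1 s) =
      coneCochain H g (fun σ => φ (translate γ.1 σ)) s := by
  simp only [coneCochain, translate_translate, Subgroup.coe_mul, mul_inv_rev, mul_assoc,
    inv_mul_cancel, mul_one]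

lemma continuous_coneCochain (g : Deck p) {n : ℕ} {φ : Cochain (n + 1) E} (hφ : Continuous φ) :
    Continuous (coneCochain H g φ) :=
  hφ.comp ((continuous_translate _).comp ((continuous_cone H).comp (continuous_translate _)))

lemma enorm_le_supNorm {n : ℕ} (φ : Cochain n E) (s : Simp n E) : ‖φ s‖ₑ ≤ supNorm φ :=
  le_iSup (fun s => ‖φ s‖ₑ) s

lemma supNorm_coneCochain_le (g : Deck p) {n : ℕ} (φ : Cochain (n + 1) E) :
    supNorm (coneCochain H g φ) ≤ supNorm φ :=
  iSup_le fun _ => enorm_le_supNorm φ _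

/-- The value of a cochain on the prism between a simplex and the simplex `s̄(g₀, …, g_n)`. -/
def prism : ∀ (n : ℕ), Cochain (n + 1) E → (Fin (n + 1) → Deck p) → Simp n E → ℝ
  | 0, φ, g, s => coneCochain H (g 0) φ s
  -- Unfolded, this is the usual prism decomposition: with sign `(-1)^i`, the iterated cone from
  -- `g₀x₀, …, g_i x₀` over the face of `s` spanned by `e_i, …, e_n`.
  | n + 1, φ, g, s => coneCochain H (g 0) φ s -
      prism n (coneCochain H (g 0) φ) (fun i => g i.succ) (s.comp (faceIncl n 0))

lemma prism_sub : ∀ {n : ℕ} (φ ψ : Cochain (n + 1) E) (g : Fin (n + 1) → Deck p)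
    (s : Simp n E), prism H n (φ - ψ) g s = prism H n φ g s - prism H n ψ g s
  | 0, _, _, _, _ => rfl
  | n + 1, φ, ψ, g, s => by
    have h : coneCochain H (g 0) (φ - ψ) = coneCochain H (g 0) φ - coneCochain H (g 0) ψ := rfl
    rw [prism, prism, prism, h, prism_sub, Pi.sub_apply]
    ring

lemma prism_coboundary_zero (φ : Cochain 0 E) (g : Fin 1 → Deck p) (s : Simp 0 E) :
    prism H 0 (coboundary 0 φ) g s = φ s - φ (orbitSimplex p H 0 g) :=
  coneCochain_coboundary_zero H (g 0) φ s

/-- The boundary of a prism is top minus bottom minus sides. The induction replaces `φ` by its cone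
cochain at `g 0`, using `coneCochain_coboundary`. -/
lemma prism_coboundary_succ : ∀ {n : ℕ} (φ : Cochain (n + 1) E) (g : Fin (n + 2) → Deck p)
    (s : Simp (n + 1) E), prism H (n + 1) (coboundary (n + 1) φ) g s =
      φ s - φ (orbitSimplex p H (n + 1) g) - ∑ i : Fin (n + 2), (-1 : ℝ) ^ (i : ℕ) *
        prism H n φ (fun j => g (i.succAbove j)) (s.comp (faceIncl n i))
  | 0, φ, g, s => by
    have h : coneCochain H (g 0) (coboundary 1 φ) = φ - coboundary 0 (coneCochain H (g 0) φ) :=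
      funext fun s => coneCochain_coboundary H (g 0) φ s
    rw [prism, h, prism_sub, prism_coboundary_zero]
    simp only [Pi.sub_apply, coboundary_apply]
    simp [prism, coneCochain, orbitSimplex]
    ring
  | n + 1, φ, g, s => by
    have h : coneCochain H (g 0) (coboundary (n + 2) φ) =
        φ - coboundary (n + 1) (coneCochain H (g 0) φ) :=
      funext fun s => coneCochain_coboundary H (g 0) φ s
    rw [prism, h, prism_sub, prism_coboundary_succ, Pi.sub_apply, coboundary_apply,
      Fin.sum_univ_succ, Fin.sum_univ_succ (n := n + 2)]
    -- Sides away from vertex 0 unfold into terms that cancel against the coboundary of the cone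
    -- cochain and the sides from the induction hypothesis.
    have hi : ∀ i : Fin (n + 2), prism H (n + 1) φ (fun j => g (i.succ.succAbove j))
        (s.comp (faceIncl (n + 1) i.succ)) =
        coneCochain H (g 0) φ (s.comp (faceIncl (n + 1) i.succ)) -
          prism H n (coneCochain H (g 0) φ) (fun j => g (i.succAbove j).succ)
            ((s.comp (faceIncl (n + 1) 0)).comp (faceIncl n i)) := by
      intro i
      rw [prism, face_succ_face_zero]
      simp only [Fin.succ_succAbove_zero, Fin.succ_succAbove_succ]
    have ho : coneCochain H (g 0) φ (orbitSimplex p H (n + 1) fun i => g i.succ) =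
        φ (orbitSimplex p H (n + 2) g) := rfl
    simp only [hi, ho, Fin.val_zero, pow_zero, one_mul, Fin.val_succ, pow_succ, mul_neg, mul_one,
      mul_sub, neg_mul, Finset.sum_sub_distrib, Finset.sum_neg_distrib, Fin.zero_succAbove]
    ring

lemma prism_translate (γ : Deck p) : ∀ {n : ℕ} (φ : Cochain (n + 1) E)
    (g : Fin (n + 1) → Deck p) (s : Simp n E),
    prism H n φ (fun i => γ * g i) (translate γ.1 s) =
      prism H n (fun σ => φ (translate γ.1 σ)) g s
  | 0, φ, g, s => coneCochain_translate H γ (g 0) φ s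
  | n + 1, φ, g, s => by
    rw [prism, prism, coneCochain_translate]
    congr 1
    have h : (fun σ => coneCochain H (γ * g 0) φ (translate γ.1 σ)) =
        coneCochain H (g 0) fun σ => φ (translate γ.1 σ) :=
      funext fun σ => coneCochain_translate H γ (g 0) φ σ
    rw [← h]
    exact prism_translate γ (coneCochain H (γ * g 0) φ) (fun i => g i.succ)
      (s.comp (faceIncl n 0))

lemma continuous_prism : ∀ {n : ℕ} {φ : Cochain (n + 1) E} (_ : Continuous φ)
    (g : Fin (n + 1) → Deck p), Continuous (prism H n φ g)
  | 0, _, hφ, g => continuous_coneCochain H (g 0) hφ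
  | _ + 1, _, hφ, g =>
    (continuous_coneCochain H (g 0) hφ).sub
      ((continuous_prism (continuous_coneCochain H (g 0) hφ) _).comp
        (ContinuousMap.continuous_precomp _))

/-- The prism consists of `n + 1` simplices. The bound is uniform in `g`, so it survives averaging.
-/
lemma enorm_prism_le : ∀ {n : ℕ} (φ : Cochain (n + 1) E) (g : Fin (n + 1) → Deck p)
    (s : Simp n E), ‖prism H n φ g s‖ₑ ≤ (n + 1) * supNorm φ
  | 0, φ, g, s => by
    simpa [prism] using
      (enorm_le_supNorm (coneCochain H (g 0) φ) s).trans (supNorm_coneCochain_le H (g 0) φ)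
  | n + 1, φ, g, s => by
    refine (enorm_sub_le).trans ?_
    rw [Nat.cast_add, Nat.cast_one, add_comm, add_mul _ _ (supNorm φ), one_mul]
    refine add_le_add ((enorm_prism_le _ _ _).trans ?_) (enorm_le_supNorm φ _)
    gcongr
    exact supNorm_coneCochain_le H _ φ

end Cone

/-! ### Homotopy retractions of cochain complexes -/

section HomotopyRetraction

variable {X : Type*} [TopologicalSpace X]

/-- Operators on singular cochains which retract a subcomplex `L` to a subcomplex `K`, up to a
homotopy preserving both, without increasing norms. -/
structure HomotopyRetraction (K L : Subcomplex X) (θ : ∀ n, Cochain n X → Cochain n X)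
    (k : ∀ n, Cochain (n + 1) X → Cochain n X) : Prop where
  le : ∀ n, K.carrier n ≤ L.carrier n
  mem : ∀ n, ∀ φ ∈ L.carrier n, θ n φ ∈ K.carrier n
  homotopy_mem_left : ∀ n, ∀ φ ∈ K.carrier (n + 1), k n φ ∈ K.carrier n
  homotopy_mem_right : ∀ n, ∀ φ ∈ L.carrier (n + 1), k n φ ∈ L.carrier n
  -- The only trace of linearity required of `k`: it removes the term `k (coboundary φ)` on
  -- cocycles.
  homotopy_zero : ∀ n, k n 0 = 0
  eq_zero : ∀ φ, θ 0 φ = φ - k 0 (coboundary 0 φ)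
  eq_succ : ∀ n φ, θ (n + 1) φ = φ - coboundary n (k n φ) - k (n + 1) (coboundary (n + 1) φ)
  supNorm_le : ∀ n φ, supNorm (θ n φ) ≤ supNorm φ

lemma cls_eq_cls_iff {K : Subcomplex X} {n : ℕ} {φ ψ : cocycles K n} :
    cls K n φ = cls K n ψ ↔ (φ - ψ : Cochain n X) ∈ coboundaries K n :=
  Submodule.Quotient.eq _

lemma cls_surjective (K : Subcomplex X) (n : ℕ) : Function.Surjective (cls K n) :=
  Submodule.mkQ_surjective _

lemma inducedMap_cls {K L : Subcomplex X} (h : ∀ n, K.carrier n ≤ L.carrier n) (n : ℕ)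
    (φ : cocycles K n) : inducedMap h n (cls K n φ) = cls L n ⟨φ, h n φ.2.1, φ.2.2⟩ := rfl

namespace HomotopyRetraction

variable {K L : Subcomplex X} {θ : ∀ n, Cochain n X → Cochain n X}
  {k : ∀ n, Cochain (n + 1) X → Cochain n X} (R : HomotopyRetraction K L θ k)
include R

lemma sub_mem_coboundaries {M : Subcomplex X}
    (hM : ∀ n, ∀ φ ∈ M.carrier (n + 1), k n φ ∈ M.carrier n) :
    ∀ {n : ℕ} {φ : Cochain n X}, φ ∈ cocycles M n → φ - θ n φ ∈ coboundaries M n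
  | 0, φ, hφ => by
    have h : coboundary 0 φ = 0 := hφ.2
    rw [R.eq_zero, h, R.homotopy_zero, sub_zero, sub_self]
    exact Submodule.zero_mem _
  | n + 1, φ, hφ => by
    have h : coboundary (n + 1) φ = 0 := hφ.2
    rw [R.eq_succ, h, R.homotopy_zero, sub_zero, sub_sub_cancel]
    exact Submodule.mem_map_of_mem (hM n φ hφ.1)

/-- `θ` is not assumed to commute with coboundaries; closedness follows because `φ - θ n φ` is a
coboundary. -/
lemma mem_cocycles {n : ℕ} {φ : Cochain n X} (hφ : φ ∈ cocycles L n) :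
    θ n φ ∈ cocycles K n := by
  refine ⟨R.mem n φ hφ.1, ?_⟩
  have h := R.sub_mem_coboundaries R.homotopy_mem_right hφ
  have h' : φ - θ n φ ∈ LinearMap.ker (coboundary n) := by
    cases n with
    | zero =>
      have h0 : φ - θ 0 φ = 0 := h
      rw [h0]
      exact Submodule.zero_mem _
    | succ n =>
      obtain ⟨η, -, hη⟩ := h
      rw [← hη]
      exact coboundary_coboundary η
  have := Submodule.sub_mem _ hφ.2 h'
  rwa [sub_sub_cancel] at this

lemma inducedMap_cls_retract {n : ℕ} (φ : cocycles L n) :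
    inducedMap R.le n (cls K n ⟨θ n φ, R.mem_cocycles φ.2⟩) = cls L n φ := by
  rw [inducedMap_cls, eq_comm, cls_eq_cls_iff]
  exact R.sub_mem_coboundaries R.homotopy_mem_right φ.2

lemma injective (n : ℕ) : Function.Injective (inducedMap R.le n) := by
  rw [injective_iff_map_eq_zero]
  intro c hc
  obtain ⟨φ, rfl⟩ := cls_surjective K n c
  have hφL : (φ : Cochain n X) ∈ coboundaries L n := by
    rw [inducedMap_cls, ← map_zero (cls L n), cls_eq_cls_iff] at hc
    simpa using hc
  rw [← map_zero (cls K n), cls_eq_cls_iff, ZeroMemClass.coe_zero, sub_zero]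
  cases n with
  | zero => exact hφL
  | succ n =>
    obtain ⟨η, hηL, hη⟩ := hφL
    have hk : ∃ ζ, coboundary n ζ = 0 ∧ θ n η = η - ζ - k n (coboundary n η) := by
      cases n with
      | zero => exact ⟨0, map_zero _, by rw [R.eq_zero, sub_zero]⟩
      | succ n => exact ⟨_, coboundary_coboundary _, R.eq_succ n η⟩
    obtain ⟨ζ, hζ, hθ⟩ := hk
    -- A primitive `η` in `L` is pushed into `K` by `θ`; adding `k n φ` restores the coboundary `φ`,
    -- since `θ n η + k n φ` differs from `η` by the closed `ζ`.
    refine ⟨θ n η + k n φ, Submodule.add_mem _ (R.mem n η hηL)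
      (R.homotopy_mem_left n _ φ.2.1), ?_⟩
    rw [hθ, hη, sub_add_cancel, map_sub, hζ, sub_zero, hη]

lemma bijective (n : ℕ) : Function.Bijective (inducedMap R.le n) := by
  refine ⟨R.injective n, fun c => ?_⟩
  obtain ⟨φ, rfl⟩ := cls_surjective L n c
  exact ⟨_, R.inducedMap_cls_retract φ⟩

lemma seminorm_inducedMap {n : ℕ} (c : Cohomology K n) :
    seminorm (inducedMap R.le n c) = seminorm c := by
  refine le_antisymm (le_iInf₂ fun ψ hψ => ?_) (le_iInf₂ fun φ hφ => ?_)
  · exact iInf₂_le_of_le (⟨ψ, R.le n ψ.2.1, ψ.2.2⟩ : cocycles L n)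
      (by rw [← hψ, inducedMap_cls]) le_rfl
  -- Each representative in `L` is retracted to one in `K` of no larger norm; injectivity shows that
  -- it represents `c`.
  · refine iInf₂_le_of_le (⟨θ n φ, R.mem_cocycles φ.2⟩ : cocycles K n) ?_ (R.supNorm_le n φ)
    exact R.injective n ((R.inducedMap_cls_retract φ).trans hφ)

end HomotopyRetraction

end HomotopyRetraction

/-! ### The retraction given by a generalized Bruhat function -/

section Retraction

variable {X E : Type*} [TopologicalSpace E]

section Mean

variable {x₀ : E} (H : (ContinuousMap.id E).Homotopy (ContinuousMap.const E x₀)) {h : E → ℝ}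

/-- The weighted mean of the values of a cochain on the prisms between a given simplex and the
simplices `s̄(g₀, …, g_n)`. -/
def prismMean (p : E → X) (h : E → ℝ) {n : ℕ} (φ : Cochain (n + 1) E) : Cochain n E := fun s =>
  ∑ᶠ g, weight p h s g * prism (p := p) H n φ g s

lemma thetaTilde_zero {p : E → X} (hh : IsBruhat p h) (φ : Cochain 0 E) :
    thetaTilde p h H φ = φ - prismMean H p h (coboundary 0 φ) := by
  funext s
  rw [Pi.sub_apply, prismMean, eq_sub_iff_add_eq, thetaTilde, ← finsum_add_distrib
    (hh.finite_support_weight_mul s _) (hh.finite_support_weight_mul s _)]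
  simp only [prism_coboundary_zero, ← mul_add, add_sub_cancel]
  rw [← finsum_mul, hh.finsum_weight, one_mul]

lemma thetaTilde_succ {p : E → X} (hh : IsBruhat p h) {n : ℕ} (φ : Cochain (n + 1) E) :
    thetaTilde p h H φ = φ - coboundary n (prismMean H p h φ) -
      prismMean H p h (coboundary (n + 1) φ) := by
  funext s
  -- Means over tuples for the faces become means over tuples for `s`, so the prism identity can be
  -- averaged term by term.
  have h1 : ∀ i : Fin (n + 2), prismMean H p h φ (s.comp (faceIncl n i)) =
      ∑ᶠ g, weight p h s g *
        prism H n φ (fun j => g (i.succAbove j)) (s.comp (faceIncl n i)) := fun i =>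
    (hh.finsum_weight_mul_face s i fun g => prism H n φ g (s.comp (faceIncl n i))).symm
  have h2 : coboundary n (prismMean H p h φ) s = ∑ᶠ g, weight p h s g *
      ∑ i : Fin (n + 2), (-1 : ℝ) ^ (i : ℕ) *
        prism H n φ (fun j => g (i.succAbove j)) (s.comp (faceIncl n i)) := by
    simp only [coboundary_apply, h1, Finset.mul_sum]
    rw [finsum_sum_comm _ _ fun i _ => hh.finite_support_weight_mul s _]
    refine Finset.sum_congr rfl fun i _ => ?_
    rw [mul_finsum]
    exact finsum_congr fun g => by ring
  rw [Pi.sub_apply, Pi.sub_apply, h2, prismMean, eq_sub_iff_add_eq, eq_sub_iff_add_eq, thetaTilde,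
    ← finsum_add_distrib (hh.finite_support_weight_mul s _) (hh.finite_support_weight_mul s _)]
  simp only [← mul_add]
  rw [← finsum_add_distrib (hh.finite_support_weight_mul s _) (hh.finite_support_weight_mul s _)]
  simp only [prism_coboundary_succ, ← mul_add]
  have h3 : ∀ a b c : ℝ, b + (a - b - c) + c = a := fun a b c => by ring
  simp only [h3]
  rw [← finsum_mul, hh.finsum_weight, one_mul]

end Mean

variable [TopologicalSpace X]

lemma coboundary_pullback (p : C(E, X)) {n : ℕ} (φ : Cochain n X) :
    coboundary n (pullback p φ) = pullback p (coboundary n φ) := rfl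

lemma continuous_pullback (p : C(E, X)) {n : ℕ} {φ : Cochain n X} (hφ : Continuous φ) :
    Continuous (pullback p φ) :=
  hφ.comp (ContinuousMap.continuous_postcomp p)

lemma pullback_translate {p : C(E, X)} {n : ℕ} (φ : Cochain n X) (γ : Deck p) (s : Simp n E) :
    pullback p φ (translate γ.1 s) = pullback p φ s :=
  congrArg φ (comp_translate γ s)

lemma pullback_injective {p : C(E, X)} (hp : IsCoveringMap p) (hsurj : Function.Surjective p)
    (n : ℕ) : Function.Injective (pullback p : Cochain n X → Cochain n E) := by
  intro φ ψ h
  funext s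
  obtain ⟨s, rfl⟩ := exists_lift_simp hp hsurj s
  exact congrFun h s

lemma supNorm_pullback {p : C(E, X)} (hp : IsCoveringMap p) (hsurj : Function.Surjective p)
    {n : ℕ} (φ : Cochain n X) : supNorm (pullback p φ) = supNorm φ :=
  Function.Surjective.iSup_comp (f := fun s : Simp n E => p.comp s)
    (fun s => exists_lift_simp hp hsurj s) (fun s => ‖φ s‖ₑ)

variable {x₀ : E} (H : (ContinuousMap.id E).Homotopy (ContinuousMap.const E x₀)) {h : E → ℝ}

variable {p : C(E, X)}

/-- Reindexing by `g ↦ γg` restores the weights and translates the orbit simplices by `γ`, which a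
pull-back does not see. -/
lemma thetaTilde_translate {n : ℕ} (φ : Cochain n X) (γ : Deck p) (s : Simp n E) :
    thetaTilde p h H (pullback p φ) (translate γ.1 s) = thetaTilde p h H (pullback p φ) s := by
  rw [thetaTilde, finsum_weight_translate]
  exact finsum_congr fun g => by rw [orbitSimplex_mul, pullback_translate]

lemma prismMean_translate {n : ℕ} (φ : Cochain (n + 1) X) (γ : Deck p) (s : Simp n E) :
    prismMean H p h (pullback p φ) (translate γ.1 s) = prismMean H p h (pullback p φ) s := by
  rw [prismMean, finsum_weight_translate]
  refine finsum_congr fun g => ?_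
  rw [prism_translate]
  simp only [pullback_translate]

lemma continuous_thetaTilde (hh : IsBruhat p h) {n : ℕ} (φ : Cochain n E) :
    Continuous (thetaTilde p h H φ) :=
  hh.continuous_finsum_weight_mul fun _ => continuous_const

lemma continuous_prismMean (hh : IsBruhat p h) {n : ℕ} {φ : Cochain (n + 1) E}
    (hφ : Continuous φ) : Continuous (prismMean H p h φ) :=
  hh.continuous_finsum_weight_mul fun g => continuous_prism H hφ g

lemma supNorm_thetaTilde_le (hh : IsBruhat p h) {n : ℕ} (φ : Cochain n E) :
    supNorm (thetaTilde p h H φ) ≤ supNorm φ :=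
  iSup_le fun s => hh.enorm_finsum_weight_mul_le s fun _ => enorm_le_supNorm φ _

lemma supNorm_prismMean_le (hh : IsBruhat p h) {n : ℕ} (φ : Cochain (n + 1) E) :
    supNorm (prismMean H p h φ) ≤ (n + 1) * supNorm φ :=
  iSup_le fun s => hh.enorm_finsum_weight_mul_le s fun _ => enorm_prism_le H φ _ s

/-- The operator on cochains of the base given by `thetaTilde`. -/
def theta (p : C(E, X)) (h : E → ℝ) (n : ℕ) (φ : Cochain n X) : Cochain n X :=
  descend p (thetaTilde p h H (pullback p φ))

/-- The operator on cochains of the base given by `prismMean`. -/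
def thetaHomotopy (p : C(E, X)) (h : E → ℝ) (n : ℕ) (φ : Cochain (n + 1) X) : Cochain n X :=
  descend p (prismMean H p h (pullback p φ))

variable [ContractibleSpace E]

lemma pullback_theta (hp : IsCoveringMap p) {n : ℕ} (φ : Cochain n X) :
    pullback p (theta H p h n φ) = thetaTilde p h H (pullback p φ) :=
  funext fun s => descend_comp hp (fun γ s => thetaTilde_translate H φ γ s) s

lemma pullback_thetaHomotopy (hp : IsCoveringMap p) {n : ℕ} (φ : Cochain (n + 1) X) :
    pullback p (thetaHomotopy H p h n φ) = prismMean H p h (pullback p φ) :=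
  funext fun s => descend_comp hp (fun γ s => prismMean_translate H φ γ s) s

/-- All identities and norms are checked on `E`, since pull-back is injective and isometric: every
simplex lifts. -/
lemma homotopyRetraction_theta (hp : IsCoveringMap p) (hsurj : Function.Surjective p)
    (hh : IsBruhat p h) {K L : Subcomplex X} (le : ∀ n, K.carrier n ≤ L.carrier n)
    (mem : ∀ n, ∀ φ ∈ L.carrier n, theta H p h n φ ∈ K.carrier n)
    (mem_left : ∀ n, ∀ φ ∈ K.carrier (n + 1), thetaHomotopy H p h n φ ∈ K.carrier n)
    (mem_right : ∀ n, ∀ φ ∈ L.carrier (n + 1), thetaHomotopy H p h n φ ∈ L.carrier n) :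
    HomotopyRetraction K L (theta H p h) (thetaHomotopy H p h) where
  le := le
  mem := mem
  homotopy_mem_left := mem_left
  homotopy_mem_right := mem_right
  homotopy_zero n := by
    apply pullback_injective hp hsurj
    rw [pullback_thetaHomotopy H hp]
    funext s
    have := (enorm_le_supNorm _ s).trans (supNorm_prismMean_le H hh (pullback p 0) (n := n))
    have h0 : supNorm (pullback p (0 : Cochain (n + 1) X)) = 0 := by simp [supNorm, pullback]
    rw [h0, mul_zero] at this
    rw [nonpos_iff_eq_zero, enorm_eq_zero] at this
    exact this
  eq_zero φ := by
    apply pullback_injective hp hsurj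
    rw [pullback_theta H hp, thetaTilde_zero H hh, coboundary_pullback,
      ← pullback_thetaHomotopy H hp]
    rfl
  eq_succ n φ := by
    apply pullback_injective hp hsurj
    rw [pullback_theta H hp, thetaTilde_succ H hh, coboundary_pullback,
      ← pullback_thetaHomotopy H hp, ← pullback_thetaHomotopy H hp]
    rfl
  supNorm_le n φ := by
    rw [← supNorm_pullback hp hsurj φ, ← supNorm_pullback hp hsurj, pullback_theta H hp]
    exact supNorm_thetaTilde_le H hh _

lemma continuous_theta (hp : IsCoveringMap p) (hsurj : Function.Surjective p)
    (hh : IsBruhat p h) {n : ℕ} (φ : Cochain n X) : Continuous (theta H p h n φ) :=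
  continuous_of_continuous_pullback hp hsurj (by
    rw [pullback_theta H hp]
    exact continuous_thetaTilde H hh _)

lemma continuous_thetaHomotopy (hp : IsCoveringMap p) (hsurj : Function.Surjective p)
    (hh : IsBruhat p h) {n : ℕ} {φ : Cochain (n + 1) X} (hφ : Continuous φ) :
    Continuous (thetaHomotopy H p h n φ) :=
  continuous_of_continuous_pullback hp hsurj (by
    rw [pullback_thetaHomotopy H hp]
    exact continuous_prismMean H hh (continuous_pullback p hφ))

lemma supNorm_thetaHomotopy_lt_top (hp : IsCoveringMap p) (hsurj : Function.Surjective p)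
    (hh : IsBruhat p h) {n : ℕ} {φ : Cochain (n + 1) X} (hφ : supNorm φ < ⊤) :
    supNorm (thetaHomotopy H p h n φ) < ⊤ := by
  rw [← supNorm_pullback hp hsurj, pullback_thetaHomotopy H hp]
  refine (supNorm_prismMean_le H hh _).trans_lt (ENNReal.mul_lt_top (by finiteness) ?_)
  rwa [supNorm_pullback hp hsurj]

lemma homotopyRetraction_contCochains (hp : IsCoveringMap p) (hsurj : Function.Surjective p)
    (hh : IsBruhat p h) : HomotopyRetraction (contCochains X) (allCochains X)
      (theta H p h) (thetaHomotopy H p h) :=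
  homotopyRetraction_theta H hp hsurj hh (fun _ => le_top)
    (fun _ φ _ => continuous_theta H hp hsurj hh φ)
    (fun _ _ hφ => continuous_thetaHomotopy H hp hsurj hh hφ) (fun _ _ _ => trivial)

lemma supNorm_theta_le (hp : IsCoveringMap p) (hsurj : Function.Surjective p)
    (hh : IsBruhat p h) {n : ℕ} (φ : Cochain n X) : supNorm (theta H p h n φ) ≤ supNorm φ :=
  (homotopyRetraction_contCochains H hp hsurj hh).supNorm_le n φ

lemma homotopyRetraction_bddContCochains (hp : IsCoveringMap p) (hsurj : Function.Surjective p)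
    (hh : IsBruhat p h) : HomotopyRetraction (bddContCochains X) (bddCochains X)
      (theta H p h) (thetaHomotopy H p h) :=
  homotopyRetraction_theta H hp hsurj hh (fun _ => inf_le_right)
    (fun _ φ hφ => ⟨continuous_theta H hp hsurj hh φ,
      (supNorm_theta_le H hp hsurj hh φ).trans_lt hφ⟩)
    (fun _ _ hφ => ⟨continuous_thetaHomotopy H hp hsurj hh hφ.1,
      supNorm_thetaHomotopy_lt_top H hp hsurj hh hφ.2⟩)
    (fun _ _ hφ => supNorm_thetaHomotopy_lt_top H hp hsurj hh hφ)

end Retraction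

end ContCohomology

end

open ContCohomology
theorem theorem1p4 {X : Type*} {E : Type*} [TopologicalSpace X] [TopologicalSpace E]
    [PathConnectedSpace X] [T2Space X] [ParacompactSpace X] [ContractibleSpace E]
    (p : C(E, X)) (hp : IsCoveringMap p) :
    ∃ (J : ∀ n, Cohomology (contCochains X) n ≃ₗ[ℝ] Cohomology (allCochains X) n)
      (Jb : ∀ n, Cohomology (bddContCochains X) n ≃ₗ[ℝ] Cohomology (bddCochains X) n),
      -- `i^*` and `i_b^*` are isometric isomorphisms
      (∀ n c, J n c = iMap X n c) ∧ (∀ n c, seminorm (J n c) = seminorm c) ∧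
      (∀ n c, Jb n c = ibMap X n c) ∧ (∀ n c, seminorm (Jb n c) = seminorm c) ∧
      -- the data entering the formulae exist
      (∃ h, IsBruhat p h) ∧
      (∃ x₀ : E, Nonempty ((ContinuousMap.id E).Homotopy (ContinuousMap.const E x₀))) ∧
      (∀ n (s : Simp n X), ∃ s' : Simp n E, p.comp s' = s) ∧
      -- the formulae for the inverses
      ∀ h : E → ℝ, IsBruhat p h →
        (∀ n (s : Simp n E), (Function.support (weight p h s)).Finite) ∧
        ∀ (x₀ : E) (H : (ContinuousMap.id E).Homotopy (ContinuousMap.const E x₀)) (n : ℕ),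
          (∀ φ : cocycles (allCochains X) n, ∃ ψ : cocycles (contCochains X) n,
            (∀ s : Simp n E, (ψ : Cochain n X) (p.comp s) = thetaTilde p h H (pullback p φ) s) ∧
            (J n).symm (cls (allCochains X) n φ) = cls (contCochains X) n ψ) ∧
          (∀ φ : cocycles (bddCochains X) n, ∃ ψ : cocycles (bddContCochains X) n,
            (∀ s : Simp n E, (ψ : Cochain n X) (p.comp s) = thetaTilde p h H (pullback p φ) s) ∧
            (Jb n).symm (cls (bddCochains X) n φ) = cls (bddContCochains X) n ψ) := by
  have hsurj := surjective_of_isCoveringMap hp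
  obtain ⟨h₀, hh₀⟩ := exists_isBruhat hp
  obtain ⟨e⟩ : Nonempty E := inferInstance
  obtain ⟨H₀⟩ := exists_homotopy_id_const e
  have R := homotopyRetraction_contCochains H₀ hp hsurj hh₀
  have Rb := homotopyRetraction_bddContCochains H₀ hp hsurj hh₀
  refine ⟨fun n => LinearEquiv.ofBijective (iMap X n) (R.bijective n),
    fun n => LinearEquiv.ofBijective (ibMap X n) (Rb.bijective n),
    fun _ _ => rfl, fun _ c => R.seminorm_inducedMap c,
    fun _ _ => rfl, fun _ c => Rb.seminorm_inducedMap c,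
    ⟨h₀, hh₀⟩, ⟨e, ⟨H₀⟩⟩, fun _ s => exists_lift_simp hp hsurj s, fun h hh =>
    ⟨fun _ s => hh.finite_support_weight s, fun x₀ H n => ⟨fun φ => ?_, fun φ => ?_⟩⟩⟩
  -- The isomorphism is `iMap` whatever data proved it bijective, so the retraction for any other
  -- `h` and `H` computes the same inverse.
  · have R' := homotopyRetraction_contCochains H hp hsurj hh
    refine ⟨⟨_, R'.mem_cocycles φ.2⟩, fun s => congrFun (pullback_theta H hp φ.1) s, ?_⟩
    rw [LinearEquiv.symm_apply_eq]
    exact (R'.inducedMap_cls_retract φ).symm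
  · have R' := homotopyRetraction_bddContCochains H hp hsurj hh
    refine ⟨⟨_, R'.mem_cocycles φ.2⟩, fun s => congrFun (pullback_theta H hp φ.1) s, ?_⟩
    rw [LinearEquiv.symm_apply_eq]
    exact (R'.inducedMap_cls_retract φ).symm
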